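/- A \emph{recursive tree} of size $n$ is a rooted non-plane tree on the $n$ labels $1,\dots,n$ whose labels increase along every path from the root to a leaf. A \emph{Pólya tree} is an unlabelled rooted non-plane tree, i.e. an isomorphism class of finite rooted trees; $|t|$ denotes the number of nodes of $t$, and $\mathcal P_{\le n}$ the set of Pólya trees with at most $n$ nodes. The fringe subtree of a tree at a node $v$ consists of $v$ and all its descendants, and its shape is the Pólya tree obtained by forgetting the labels. Let $X_n$ be the size of the compacted tree of a uniformly random recursive tree of size $n$, that is, the number of distinct shapes of its fringe subtrees. Let $T(z)$ be the exponential generating function of recursive trees and, for a Pólya tree $t$, let $S_t(z)$ be the exponential generating function of the recursive trees that have no fringe subtree of shape $t$. Let $\sigma\approx 0.338$ be the dominant singularity (the radius of convergence) of the ordinary generating function of Pólya trees, and let $\log$ denote the logarithm to base $1/\sigma$. Then, for all $n\ge 1$, \[ \mathbb E(X_n)=\sum_{\substack{t\in\mathcal P_{\le n}\\ |t|<\log n}}\Bigl(1-\frac{[z^n]S_t(z)}{[z^n]T(z)}\Bigr)+\sum_{\substack{t\in\mathcal P_{\le n}\\ |t|\ge\log n}}\Bigl(1-\frac{[z^n]S_t(z)}{[z^n]T(z)}\Bigr),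 \] and, as $n\to\infty$, the second sum satisfies \[ \sum_{\substack{t\in\mathcal P_{\le n}\\ |t|\ge\log n}}\Bigl(1-\frac{[z^n]S_t(z)}{[z^n]T(z)}\Bigr)=\Omega(\sqrt n). \] Consequently $\mathbb E(X_n)=\Omega(\sqrt n)$. Here $a_n=\Omega(b_n)$ means that there are $c>0$ and $N$ with $a_n\ge c\,b_n$ for all $n\ge N$. -/

import Mathlib

/-- A rooted (non-plane) tree on the vertex set `V`, given by its root and its parent map. By
convention the root is its own parent; every vertex reaches the root by iterating the parent map,
which makes the root the only fixed point and excludes cycles. -/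
@[ext]
structure ParentTree (V : Type*) where
  root : V
  parent : V → V
  parent_root : parent root = root
  reaches_root : ∀ v, ∃ m : ℕ, parent^[m] v = root

namespace ParentTree

/-- Isomorphism of rooted trees: a bijection of the vertices that respects roots and parents. -/
def Iso {V W : Type*} (T : ParentTree V) (T' : ParentTree W) : Prop :=
  ∃ e : V ≃ W, e T.root = T'.root ∧ ∀ v, e (T.parent v) = T'.parent (e v)

/-- The same tree with its vertices renamed along a bijection. -/
def relabel {V W : Type*} (T : ParentTree V) (e : V ≃ W) : ParentTree W where
  root := e T.root
  parent w := e (T.parent (e.symm w))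
  parent_root := by simp [T.parent_root]
  reaches_root w := by
    obtain ⟨m, hm⟩ := T.reaches_root (e.symm w)
    refine ⟨m, ?_⟩
    have h : Function.Semiconj e T.parent (fun w => e (T.parent (e.symm w))) := fun v => by simp
    have := (h.iterate_right m) (e.symm w)
    rw [hm] at this
    simpa using this.symm

/-- The vertices of the fringe subtree at `v`: the vertex `v` and all its descendants. -/
abbrev Descendant {V : Type*} (T : ParentTree V) (v : V) : Type _ :=
  {u : V // ∃ m : ℕ, T.parent^[m] u = v}

open Classical in
/-- The fringe subtree of `T` at `v`: the tree of all descendants of `v`, rooted at `v`. -/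
noncomputable def fringe {V : Type*} (T : ParentTree V) (v : V) :
    ParentTree (T.Descendant v) where
  root := ⟨v, 0, rfl⟩
  parent u := if h : u.1 = v then ⟨v, 0, rfl⟩ else ⟨T.parent u.1, by
    obtain ⟨m, hm⟩ := u.2
    cases m with
    | zero => exact absurd hm h
    | succ m => exact ⟨m, by simpa using hm⟩⟩
  parent_root := by simp
  reaches_root := by
    rintro ⟨u, m, hm⟩
    induction m generalizing u with
    | zero => exact ⟨0, Subtype.ext hm⟩
    | succ m ih =>
      by_cases h : u = v
      · exact ⟨0, Subtype.ext h⟩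
      · obtain ⟨j, hj⟩ := ih (T.parent u) (by simpa using hm)
        exact ⟨j + 1, by rw [Function.iterate_succ_apply, dif_neg h]; exact hj⟩

instance {V : Type*} [Finite V] : Finite (ParentTree V) :=
  Finite.of_injective (fun T : ParentTree V => (T.root, T.parent)) fun T T' h => by
    simp only [Prod.mk.injEq] at h
    exact ParentTree.ext h.1 h.2

/-- Isomorphism as an equivalence relation on the rooted trees with vertex set `V`. -/
def isoSetoid (V : Type*) : Setoid (ParentTree V) where
  r := Iso
  iseqv :=
    { refl := fun _ => ⟨Equiv.refl _, rfl, fun _ => rfl⟩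
      symm := by
        rintro T T' ⟨e, hr, hp⟩
        exact ⟨e.symm, by simp [← hr], fun w => by simp [Equiv.symm_apply_eq, hp]⟩
      trans := by
        rintro T T' T'' ⟨e, hr, hp⟩ ⟨f, hr', hp'⟩
        exact ⟨e.trans f, by simp [hr, hr'], fun v => by simp [hp, hp']⟩ }

end ParentTree

/-- Pólya trees (unlabelled rooted non-plane trees) with `k` nodes: isomorphism classes of rooted
trees on `k` vertices. -/
abbrev PolyaTreeOfSize (k : ℕ) : Type := Quotient (ParentTree.isoSetoid (Fin k))

noncomputable instance (k : ℕ) : Fintype (PolyaTreeOfSize k) := Fintype.ofFinite _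

/-- The class of all Pólya trees. -/
abbrev PolyaTree : Type := Σ k : ℕ, PolyaTreeOfSize k

/-- The size (number of nodes) of a Pólya tree. -/
def PolyaTree.size (t : PolyaTree) : ℕ := t.1

/-- The finite set of all Pólya trees of size at most `n`. -/
noncomputable def polyaTreesLE (n : ℕ) : Finset PolyaTree :=
  (Finset.range (n + 1)).sigma fun _ => Finset.univ

/-- The shape of a finite rooted tree: the Pólya tree obtained by forgetting vertex names. -/
noncomputable def ParentTree.shape {V : Type*} [Finite V] (T : ParentTree V) : PolyaTree :=
  ⟨Nat.card V, Quotient.mk (ParentTree.isoSetoid _) (T.relabel (Finite.equivFin V))⟩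

/-- Recursive trees of size `n`: rooted non-plane trees on `n` linearly ordered labels whose labels
increase along every path from the root to a leaf. -/
abbrev RecursiveTree (n : ℕ) : Type :=
  {T : ParentTree (Fin n) // ∀ v, v ≠ T.root → T.parent v < v}

noncomputable instance (n : ℕ) : Fintype (RecursiveTree n) := Fintype.ofFinite _

/-- The Pólya tree `t` is the shape of some fringe subtree of the recursive tree `τ`. -/
def Occurs {n : ℕ} (t : PolyaTree) (τ : RecursiveTree n) : Prop :=
  ∃ v : Fin n, (τ.1.fringe v).shape = t

/-- The size of the compacted tree of `τ`: the number of distinct shapes of fringe subtrees. -/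
noncomputable def compactedSize {n : ℕ} (τ : RecursiveTree n) : ℕ :=
  Set.ncard {t : PolyaTree | Occurs t τ}

/-- The expectation of the compacted size for a uniformly random recursive tree of size `n`. -/
noncomputable def expectedCompactedSize (n : ℕ) : ℝ :=
  (∑ τ : RecursiveTree n, (compactedSize τ : ℝ)) / Nat.card (RecursiveTree n)

/-- The exponential generating function of recursive trees. -/
noncomputable def recursiveEGF : PowerSeries ℝ :=
  PowerSeries.mk fun n => (Nat.card (RecursiveTree n) : ℝ) / n.factorial

/-- The exponential generating function of the recursive trees that have no fringe subtree of
shape `t`. -/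
noncomputable def avoidingEGF (t : PolyaTree) : PowerSeries ℝ :=
  PowerSeries.mk fun n => (Nat.card {τ : RecursiveTree n // ¬ Occurs t τ} : ℝ) / n.factorial

/-- The dominant singularity of the ordinary generating function of Pólya trees. The coefficients
being nonnegative, it is the radius of convergence of this series. -/
noncomputable def polyaSingularity : ℝ :=
  (FormalMultilinearSeries.ofScalars ℂ
    (fun k : ℕ => (Nat.card (PolyaTreeOfSize k) : ℂ))).radius.toReal

/-- The logarithm to base `1 / σ`, where `σ` is the dominant singularity of the generating function
of Pólya trees. -/
noncomputable def polyaLog (x : ℝ) : ℝ := Real.logb (1 / polyaSingularity) x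

/-- The summand `1 - [zⁿ] S_t(z) / [zⁿ] T(z)`: the probability that `t` occurs as the shape of a
fringe subtree of a uniformly random recursive tree of size `n`. -/
noncomputable def shapeContribution (n : ℕ) (t : PolyaTree) : ℝ :=
  1 - PowerSeries.coeff n (avoidingEGF t) / PowerSeries.coeff n recursiveEGF

open Classical in
/-- The contribution of the shapes `t` of size at most `n` with `|t| < log n`. -/
noncomputable def smallShapeSum (n : ℕ) : ℝ :=
  ∑ t ∈ (polyaTreesLE n).filter (fun t => (t.size : ℝ) < polyaLog n), shapeContribution n t

open Classical in
/-- The contribution of the shapes `t` of size at most `n` with `|t| ≥ log n`. -/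
noncomputable def largeShapeSum (n : ℕ) : ℝ :=
  ∑ t ∈ (polyaTreesLE n).filter (fun t => polyaLog n ≤ (t.size : ℝ)), shapeContribution n t

/-!
Fix `m ≈ √n / 2` and look at the tree formed by the first `m + 1` nodes. On average half of its
nodes are leaves, and a leaf `i` of this initial tree is the root of a fringe subtree consisting of
exactly those nodes whose first ancestor among `0, …, m` is `i`. The sizes of these blocks form a
uniformly random composition of `n` into `m + 1` positive parts. Merging two equal parts shows that
two given parts are at most as likely to be equal as one of them is to be `1`, which has probability
at most `m / n`. Hence collisions of sizes cost at most half of the leaves on average, and the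
remaining `(m + 1) / 4` fringe subtrees have distinct shapes because they have distinct sizes. Only
`o(√n)` of these sizes lie below a threshold that is `o(√n)`, such as the logarithm.
-/

open Finset Filter
open scoped Nat

theorem card_le_card_image_add_card_collisions {α β : Type*} [DecidableEq β]
    (s : Finset α) (f : α → β) :
    #s ≤ #(s.image f) + #{x ∈ s.offDiag | f x.1 = f x.2} := by
  classical
  induction s using Finset.induction_on with
  | empty => simp
  | insert a s ha ih =>
    have hmono : {x ∈ s.offDiag | f x.1 = f x.2} ⊆ {x ∈ (insert a s).offDiag | f x.1 = f x.2} :=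
      filter_subset_filter _ (offDiag_mono (subset_insert a s))
    by_cases hf : f a ∈ s.image f
    · obtain ⟨b, hb, hab⟩ := mem_image.1 hf
      have hlt : #{x ∈ s.offDiag | f x.1 = f x.2} < #{x ∈ (insert a s).offDiag | f x.1 = f x.2} :=
        card_lt_card <| hmono.ssubset_of_mem_notMem (a := (a, b))
          (by simp [hb, hab, ne_of_mem_of_not_mem hb ha |>.symm]) (by simp [ha])
      rw [card_insert_of_notMem ha, image_insert, insert_eq_of_mem hf]
      lia
    · rw [card_insert_of_notMem ha, image_insert, card_insert_of_notMem hf]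
      have := card_le_card hmono
      lia

theorem card_filter_piAntidiag_eq_le {ι : Type*} [DecidableEq ι] {s : Finset ι} {i j : ι}
    (hi : i ∈ s) (hj : j ∈ s) (hij : i ≠ j) (d : ℕ) :
    #{x ∈ s.piAntidiag d | x i = x j} ≤ #{x ∈ s.piAntidiag d | x j = 0} := by
  -- Merging part `j` into part `i` loses nothing when the two are equal.
  let merge (x : ι → ℕ) : ι → ℕ := Function.update (Function.update x i (x i + x j)) j 0
  have sum_merge (x : ι → ℕ) : ∑ l ∈ s, merge x l = ∑ l ∈ s, x l := by
    have hi' : i ∈ s \ {j} := by simp [hi, hij]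
    rw [sum_update_of_mem hj, sum_update_of_mem hi', sum_eq_add_sum_sdiff_singleton_of_mem hj x,
      sum_eq_add_sum_sdiff_singleton_of_mem hi' x]
    ring
  refine card_le_card_of_injOn merge (fun x hx => ?_) fun x hx y hy hxy => funext fun l => ?_
  · simp only [coe_filter, mem_piAntidiag, Set.mem_ofPred_eq] at hx ⊢
    refine ⟨⟨(sum_merge x).trans hx.1.1, fun l hl => ?_⟩, by simp [merge]⟩
    by_contra hls
    have hli : l ≠ i := fun h => hls (h ▸ hi)
    have hlj : l ≠ j := fun h => hls (h ▸ hj)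
    exact hls (hx.1.2 l (by simpa [merge, hli, hlj] using hl))
  · have hmerge := congrFun hxy
    have hi2 : x i + x j = y i + y j := by simpa [merge, hij] using hmerge i
    have hx2 : x i = x j := (mem_filter.1 hx).2
    have hy2 : y i = y j := (mem_filter.1 hy).2
    by_cases hli : l = i
    · subst hli; lia
    by_cases hlj : l = j
    · subst hlj; lia
    simpa [merge, hli, hlj] using hmerge l

namespace RecursiveTree

variable {n : ℕ}

theorem root_eq_zero (τ : RecursiveTree (n + 1)) : τ.1.root = 0 := by
  by_contra h
  exact (Fin.zero_le _).not_gt (τ.2 0 (Ne.symm h))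

theorem parent_zero (τ : RecursiveTree (n + 1)) : τ.1.parent 0 = 0 := by
  simpa only [root_eq_zero] using τ.1.parent_root

theorem parent_lt (τ : RecursiveTree (n + 1)) {v : Fin (n + 1)} (hv : v ≠ 0) :
    τ.1.parent v < v :=
  τ.2 v (by rwa [root_eq_zero])

theorem ext_parent {τ τ' : RecursiveTree (n + 1)} (h : ∀ v, τ.1.parent v = τ'.1.parent v) :
    τ = τ' :=
  Subtype.ext <| ParentTree.ext (by rw [root_eq_zero, root_eq_zero]) (funext h)

/-- The recursive tree with parent map `f`; the label `0` is the root and hence its own parent. -/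
def ofParent (f : Fin (n + 1) → Fin (n + 1)) (h0 : f 0 = 0) (hf : ∀ v ≠ 0, f v < v) :
    RecursiveTree (n + 1) where
  val :=
    { root := 0
      parent := f
      parent_root := h0
      reaches_root := fun v => by
        induction v using WellFoundedLT.induction with
        | ind v ih =>
          by_cases hv : v = 0
          · exact ⟨0, hv⟩
          · obtain ⟨k, hk⟩ := ih (f v) (hf v hv)
            exact ⟨k + 1, hk⟩ }
  property := hf

/-- The recursive tree obtained from `τ` by attaching the next label as a child of `q`. -/
def attach (τ : RecursiveTree (n + 1)) (q : Fin (n + 1)) : RecursiveTree (n + 2) :=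
  ofParent (Fin.lastCases q.castSucc fun v => (τ.1.parent v).castSucc)
    (by rw [← Fin.castSucc_zero, Fin.lastCases_castSucc, parent_zero])
    fun v => v.lastCases (fun _ => by simp [Fin.castSucc_lt_last]) fun v hv => by
      simpa using parent_lt τ (mt (congrArg Fin.castSucc) hv)

@[simp]
theorem parent_attach_castSucc (τ : RecursiveTree (n + 1)) (q v : Fin (n + 1)) :
    (attach τ q).1.parent v.castSucc = (τ.1.parent v).castSucc :=
  Fin.lastCases_castSucc (motive := fun _ => Fin (n + 2)) v

@[simp]
theorem parent_attach_last (τ : RecursiveTree (n + 1)) (q : Fin (n + 1)) :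
    (attach τ q).1.parent (Fin.last (n + 1)) = q.castSucc :=
  Fin.lastCases_last (motive := fun _ => Fin (n + 2))

theorem attach_bijective :
    Function.Bijective fun x : RecursiveTree (n + 1) × Fin (n + 1) => attach x.1 x.2 := by
  constructor
  · rintro ⟨τ, q⟩ ⟨τ', q'⟩ h
    have hparent := fun v => congrArg (fun τ : RecursiveTree (n + 2) => τ.1.parent v) h
    refine Prod.ext (ext_parent fun v => ?_) ?_
    · simpa using hparent v.castSucc
    · simpa using hparent (Fin.last _)
  · intro τ
    have hlt : ∀ v, τ.1.parent v ≠ Fin.last (n + 1) := fun v => by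
      by_cases hv : v = 0
      · rw [hv, parent_zero]
        exact (Fin.last_pos).ne
      · exact ((parent_lt τ hv).trans_le (Fin.le_last v)).ne
    refine ⟨(ofParent (fun v => (τ.1.parent v.castSucc).castPred (hlt _)) ?_ fun v hv => ?_,
      (τ.1.parent (Fin.last _)).castPred (hlt _)), ext_parent fun v => ?_⟩
    · simp [parent_zero]
    · simpa [Fin.lt_def] using parent_lt τ (v := v.castSucc) (by simpa using hv)
    · induction v using Fin.lastCases with
      | last => simp
      | cast v => simp [ofParent]

theorem sum_recursiveTree_succ {M : Type*} [AddCommMonoid M] (g : RecursiveTree (n + 2) → M) :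
    ∑ τ, g τ = ∑ τ : RecursiveTree (n + 1), ∑ q, g (attach τ q) := by
  rw [← attach_bijective.sum_comp, Fintype.sum_prod_type]

theorem card_eq_factorial (n : ℕ) : Fintype.card (RecursiveTree (n + 1)) = n ! := by
  induction n with
  | zero =>
    exact Fintype.card_eq_one_iff.2 ⟨ofParent id rfl fun v hv => absurd (Fin.fin_one_eq_zero v) hv,
      fun τ => ext_parent fun _ => Subsingleton.elim (α := Fin 1) _ _⟩
  | succ n ih =>
    rw [← Fintype.card_of_bijective attach_bijective, Fintype.card_prod, ih, Fintype.card_fin,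
      Nat.factorial_succ, mul_comm]

/-- No node `w` with `s < w ≤ e` is a child of node `i`. As `s < w`, the root, which is its
own parent, is not counted as its own child. -/
def NoChildIn (τ : RecursiveTree (n + 1)) (i s e : ℕ) : Prop :=
  ∀ w : Fin (n + 1), s < w → w ≤ e → (τ.1.parent w : ℕ) ≠ i

theorem noChildIn_attach_of_le {e : ℕ} (he : e ≤ n) {τ : RecursiveTree (n + 1)} {q : Fin (n + 1)}
    {i s : ℕ} : NoChildIn (attach τ q) i s e ↔ NoChildIn τ i s e := by
  simp [NoChildIn, Fin.forall_fin_succ', show ¬ n + 1 ≤ e by lia]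

theorem noChildIn_attach_last {s : ℕ} (hs : s ≤ n) {τ : RecursiveTree (n + 1)} {q : Fin (n + 1)}
    {i : ℕ} : NoChildIn (attach τ q) i s (n + 1) ↔ NoChildIn τ i s n ∧ (q : ℕ) ≠ i := by
  simp [NoChildIn, Fin.forall_fin_succ', Fin.is_le, Nat.lt_succ_of_le hs]

open Classical in
theorem card_noChildIn {i s e : ℕ} (his : i ≤ s) (hse : s ≤ e) (hen : e ≤ n) :
    #{τ : RecursiveTree (n + 1) | NoChildIn τ i s e} * e = n ! * s := by
  induction n generalizing e with
  | zero =>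
    obtain ⟨rfl, rfl⟩ : e = 0 ∧ s = 0 := by lia
    simp
  | succ n ih =>
    rcases hse.eq_or_lt with rfl | hlt
    · have hvacuous (τ : RecursiveTree (n + 2)) : NoChildIn τ i s s := fun w _ _ => by lia
      simp [hvacuous, card_eq_factorial]
    simp only [card_filter, sum_recursiveTree_succ]
    rcases hen.eq_or_lt with rfl | hen
    · have hparents : #{q : Fin (n + 1) | (q : ℕ) ≠ i} = n := by
        have herase : ({q : Fin (n + 1) | (q : ℕ) ≠ i} : Finset _) = univ.erase ⟨i, by lia⟩ := by
          ext q
          simp [Fin.ext_iff]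
        rw [herase, card_erase_of_mem (mem_univ _), card_univ, Fintype.card_fin, Nat.add_sub_cancel]
      simp only [noChildIn_attach_last (Nat.le_of_lt_succ hlt), ite_and, sum_ite_irrel,
        sum_const_zero, sum_boole, hparents, Nat.cast_id]
      rw [← sum_filter, sum_const, smul_eq_mul, ih (by lia) le_rfl, Nat.factorial_succ]
      ring
    · simp only [noChildIn_attach_of_le (Nat.le_of_lt_succ hen), sum_const, card_univ,
        Fintype.card_fin, smul_eq_mul, ← mul_sum, ← card_filter]
      rw [mul_assoc, ih hlt.le (by lia), Nat.factorial_succ]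
      ring

/-- The first ancestor of `v` (including `v` itself) that is one of the nodes `0, …, m`. Its fibres
partition `τ` into `m + 1` blocks, the pieces hanging off the initial tree on `0, …, m`. -/
def block (m : ℕ) (τ : RecursiveTree (n + 1)) (v : Fin (n + 1)) : Fin (m + 1) :=
  if h : (v : ℕ) ≤ m then ⟨v, Nat.lt_succ_of_le h⟩ else block m τ (τ.1.parent v)
termination_by v
decreasing_by exact parent_lt τ (by rintro rfl; simp at h)

theorem val_block_of_le {m : ℕ} (τ : RecursiveTree (n + 1)) {v : Fin (n + 1)} (h : (v : ℕ) ≤ m) :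
    (block m τ v : ℕ) = v := by
  rw [block, dif_pos h]

theorem block_of_lt {m : ℕ} (τ : RecursiveTree (n + 1)) {v : Fin (n + 1)} (h : m < (v : ℕ)) :
    block m τ v = block m τ (τ.1.parent v) := by
  rw [block, dif_neg h.not_ge]

theorem block_attach_castSucc (m : ℕ) (τ : RecursiveTree (n + 1)) (q v : Fin (n + 1)) :
    block m (attach τ q) v.castSucc = block m τ v := by
  induction v using WellFoundedLT.induction with
  | ind v ih =>
    rcases le_or_gt (v : ℕ) m with hv | hv
    · apply Fin.ext
      rw [val_block_of_le τ hv, val_block_of_le _ (by simpa using hv), Fin.val_castSucc]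
    · rw [block_of_lt τ hv, block_of_lt _ (by simpa using hv), parent_attach_castSucc,
        ih _ (parent_lt τ (by rintro rfl; simp at hv))]

theorem block_attach_last {m : ℕ} (hm : m ≤ n) (τ : RecursiveTree (n + 1)) (q : Fin (n + 1)) :
    block m (attach τ q) (Fin.last (n + 1)) = block m τ q := by
  rw [block_of_lt _ (by simpa using Nat.lt_succ_of_le hm), parent_attach_last,
    block_attach_castSucc]

/-- The number of nodes in the block of `i`, where `i` is one of the nodes `0, …, m`. -/
def blockSize (m : ℕ) (τ : RecursiveTree (n + 1)) (i : Fin (m + 1)) : ℕ :=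
  #{v | block m τ v = i}

theorem blockSize_attach {m : ℕ} (hm : m ≤ n) (τ : RecursiveTree (n + 1)) (q : Fin (n + 1)) :
    blockSize m (attach τ q) = blockSize m τ + Pi.single (block m τ q) 1 := by
  ext i
  simp only [blockSize, card_filter, Fin.sum_univ_castSucc, block_attach_castSucc,
    block_attach_last hm, Pi.add_apply, Pi.single_apply, eq_comm (a := i)]

theorem blockSize_self {m : ℕ} (τ : RecursiveTree (m + 1)) : blockSize m τ = 1 := by
  have hblock : ∀ v, block m τ v = v := fun v => Fin.ext (val_block_of_le τ v.is_le)
  ext i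
  simp [blockSize, hblock, filter_eq']

theorem sum_block (m : ℕ) (τ : RecursiveTree (n + 1)) (g : Fin (m + 1) → ℕ) :
    ∑ v, g (block m τ v) = ∑ i, blockSize m τ i * g i := by
  simp only [← sum_fiberwise' univ (block m τ) g, sum_const, smul_eq_mul, blockSize]

theorem sum_blockSize (m : ℕ) (τ : RecursiveTree (n + 1)) : ∑ i, blockSize m τ i = n + 1 := by
  simpa using (sum_block m τ 1).symm

theorem one_le_blockSize {m : ℕ} (hm : m ≤ n) (τ : RecursiveTree (n + 1)) (i : Fin (m + 1)) :
    1 ≤ blockSize m τ i :=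
  card_pos.2 ⟨i.castLE (Nat.succ_le_succ hm), by
    rw [mem_filter_univ]
    exact Fin.ext (val_block_of_le (m := m) τ i.is_le)⟩

open Classical in
theorem card_blockSize_eq_succ {m : ℕ} (hm : m ≤ n) (x : Fin (m + 1) → ℕ) :
    #{τ : RecursiveTree (n + 2) | blockSize m τ = x + 1} =
      ∑ i, x i * #{τ : RecursiveTree (n + 1) | blockSize m τ + Pi.single i 1 = x + 1} := by
  calc #{τ : RecursiveTree (n + 2) | blockSize m τ = x + 1}
    _ = ∑ τ : RecursiveTree (n + 1), ∑ i, blockSize m τ i *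
        if blockSize m τ + Pi.single i 1 = x + 1 then 1 else 0 := by
      simp only [card_filter, sum_recursiveTree_succ, blockSize_attach hm]
      exact sum_congr rfl fun τ _ =>
        sum_block m τ fun i => if blockSize m τ + Pi.single i 1 = x + 1 then 1 else 0
    _ = ∑ i, x i * #{τ : RecursiveTree (n + 1) | blockSize m τ + Pi.single i 1 = x + 1} := by
      rw [sum_comm]
      simp only [card_filter, mul_sum]
      refine sum_congr rfl fun i _ => sum_congr rfl fun τ _ => ?_
      split_ifs with h
      · simpa using congrFun h i
      · rfl

open Classical in
/-- The block sizes evolve as a Pólya urn: the next node joins a block with probability proportional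
to its size. -/
theorem card_blockSize_eq {m d : ℕ} {x : Fin (m + 1) → ℕ} (hx : ∑ i, x i = d) :
    #{τ : RecursiveTree (m + d + 1) | blockSize m τ = x + 1} = m ! * d ! := by
  induction d generalizing x with
  | zero =>
    obtain rfl : x = 0 := by simpa [funext_iff] using hx
    simp [blockSize_self, card_eq_factorial]
  | succ d ih =>
    have hgrow (i : Fin (m + 1)) :
        x i * #{τ : RecursiveTree (m + d + 1) | blockSize m τ + Pi.single i 1 = x + 1} =
          x i * (m ! * d !) := by
      rcases Nat.eq_zero_or_pos (x i) with hzero | hpos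
      · rw [hzero, zero_mul, zero_mul]
      obtain ⟨y, rfl⟩ : ∃ y : Fin (m + 1) → ℕ, x = y + Pi.single i 1 :=
        ⟨x - Pi.single i 1, (tsub_add_cancel_of_le fun l => by
          rcases eq_or_ne l i with rfl | hl <;> simp [*, Nat.one_le_iff_ne_zero, hpos.ne']).symm⟩
      have hy : ∑ l, y l = d := by simpa [sum_add_distrib] using hx
      rw [add_right_comm y]
      simp only [add_left_inj, ih hy]
    calc #{τ : RecursiveTree (m + (d + 1) + 1) | blockSize m τ = x + 1}
      _ = ∑ i, x i * #{τ : RecursiveTree (m + d + 1) | blockSize m τ + Pi.single i 1 = x + 1} :=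
        card_blockSize_eq_succ (Nat.le_add_right m d) x
      _ = m ! * (d + 1)! := by
        simp only [hgrow, ← sum_mul, hx, Nat.factorial_succ]
        ring

open Classical in
theorem card_filter_blockSize (m d : ℕ) (P : (Fin (m + 1) → ℕ) → Prop) [DecidablePred P] :
    #{τ : RecursiveTree (m + d + 1) | P (blockSize m τ)} =
      #{x ∈ piAntidiag univ d | P (x + 1)} * (m ! * d !) := by
  have sub_one_add_one (τ : RecursiveTree (m + d + 1)) : blockSize m τ - 1 + 1 = blockSize m τ :=
    tsub_add_cancel_of_le fun i => one_le_blockSize (Nat.le_add_right m d) τ i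
  have sum_sub_one (τ : RecursiveTree (m + d + 1)) : ∑ i, (blockSize m τ i - 1) = d := by
    rw [sum_tsub_distrib _ fun i _ => one_le_blockSize (Nat.le_add_right m d) τ i, sum_blockSize,
      sum_const, card_univ, Fintype.card_fin, smul_eq_mul]
    lia
  have hcomposition : ∀ τ ∈ ({τ | P (blockSize m τ)} : Finset (RecursiveTree (m + d + 1))),
      blockSize m τ - 1 ∈ ({x ∈ piAntidiag univ d | P (x + 1)} : Finset _) := fun τ hτ => by
    simpa [sub_one_add_one, sum_sub_one] using hτ
  rw [card_eq_sum_card_fiberwise hcomposition]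
  refine sum_const_nat fun x hx => ?_
  simp only [mem_filter, mem_piAntidiag] at hx
  rw [← card_blockSize_eq hx.1.1, filter_filter]
  congr 1
  refine filter_congr fun τ _ => ⟨fun h => ?_, fun h => ?_⟩
  · rw [← h.2, sub_one_add_one]
  · rw [h]
    exact ⟨hx.2, add_tsub_cancel_right x 1⟩

open Classical in
theorem card_blockSize_eq_one_mul_le {m : ℕ} (hm : m ≤ n) (i : Fin (m + 1)) :
    #{τ : RecursiveTree (n + 1) | blockSize m τ i = 1} * n ≤ n ! * m := by
  rw [← card_noChildIn (i := i) i.is_le hm le_rfl]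
  refine Nat.mul_le_mul_right n (card_le_card fun τ hτ => ?_)
  simp only [mem_filter_univ] at hτ ⊢
  intro w hmw _ hw
  set v : Fin (n + 1) := i.castLE (Nat.succ_le_succ hm)
  have hv : block m τ v = i := Fin.ext (val_block_of_le τ i.is_le)
  have hwi : block m τ w = i := by
    rw [block_of_lt τ hmw, ← hv]
    exact congrArg _ (Fin.ext hw)
  have hwv : w = v :=
    card_le_one.1 hτ.le w ((mem_filter_univ w).2 hwi) v ((mem_filter_univ v).2 hv)
  exact hmw.not_ge (hwv ▸ i.is_le)

open Classical in
theorem card_blockSize_eq_blockSize_mul_le {m : ℕ} (hm : m ≤ n) {i j : Fin (m + 1)} (hij : i ≠ j) :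
    #{τ : RecursiveTree (n + 1) | blockSize m τ i = blockSize m τ j} * n ≤ n ! * m := by
  refine le_trans (Nat.mul_le_mul_right n ?_) (card_blockSize_eq_one_mul_le hm j)
  obtain ⟨d, rfl⟩ := Nat.exists_eq_add_of_le hm
  rw [card_filter_blockSize m d fun k => k i = k j, card_filter_blockSize m d fun k => k j = 1]
  simpa using Nat.mul_le_mul_right (m ! * d !)
    (card_filter_piAntidiag_eq_le (mem_univ i) (mem_univ j) hij d)

open Classical in
/-- The leaves of the recursive tree formed by the first `m + 1` nodes of `τ`. -/
noncomputable def leavesUpTo (m : ℕ) (τ : RecursiveTree (n + 1)) : Finset (Fin (m + 1)) :=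
  {i | NoChildIn τ i i m}

theorem two_mul_sum_card_leavesUpTo {m : ℕ} (hm : 1 ≤ m) (hmn : m ≤ n) :
    2 * ∑ τ : RecursiveTree (n + 1), #(leavesUpTo m τ) = n ! * (m + 1) := by
  classical
  refine Nat.eq_of_mul_eq_mul_right hm ?_
  calc 2 * (∑ τ : RecursiveTree (n + 1), #(leavesUpTo m τ)) * m
    _ = 2 * ∑ i : Fin (m + 1), #{τ : RecursiveTree (n + 1) | NoChildIn τ i i m} * m := by
      simp only [leavesUpTo, card_filter]
      rw [sum_comm, mul_assoc, sum_mul]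
    _ = n ! * ((∑ i ∈ range (m + 1), i) * 2) := by
      simp only [card_noChildIn le_rfl (Fin.is_le _) hmn, ← mul_sum,
        Fin.sum_univ_eq_sum_range (fun i => i)]
      ring
    _ = n ! * (m + 1) * m := by
      rw [sum_range_id_mul_two, Nat.add_sub_cancel, mul_assoc]

theorem sum_card_collisions_mul_le {m : ℕ} (hm : m ≤ n) :
    (∑ τ : RecursiveTree (n + 1), #{x ∈ (leavesUpTo m τ).offDiag |
      blockSize m τ x.1 = blockSize m τ x.2}) * n ≤ (m + 1) * m * (n ! * m) := by
  classical
  calc _ ≤ (∑ τ : RecursiveTree (n + 1), #{x ∈ (univ : Finset (Fin (m + 1))).offDiag |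
        blockSize m τ x.1 = blockSize m τ x.2}) * n := by
        gcongr
        exact subset_univ _
    _ = ∑ x ∈ (univ : Finset (Fin (m + 1))).offDiag,
        #{τ : RecursiveTree (n + 1) | blockSize m τ x.1 = blockSize m τ x.2} * n := by
        simp only [card_filter]
        rw [sum_comm, sum_mul]
    _ ≤ ∑ _x ∈ (univ : Finset (Fin (m + 1))).offDiag, n ! * m :=
        sum_le_sum fun x hx => card_blockSize_eq_blockSize_mul_le hm (mem_offDiag.1 hx).2.2
    _ = (m + 1) * m * (n ! * m) := by
        rw [sum_const, offDiag_card, card_univ, Fintype.card_fin, ← Nat.mul_sub_one,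
          Nat.add_sub_cancel, smul_eq_mul]

theorem factorial_mul_le_four_mul_sum_card_image_blockSize {m : ℕ} (hm : 1 ≤ m)
    (hmn : 4 * m ^ 2 ≤ n) :
    n ! * (m + 1) ≤
      4 * ∑ τ : RecursiveTree (n + 1), #((leavesUpTo m τ).image (blockSize m τ)) := by
  have hle : m ≤ n := by nlinarith
  have hleaves := two_mul_sum_card_leavesUpTo hm hle
  have hcoll := sum_card_collisions_mul_le hle
  set collisions := ∑ τ : RecursiveTree (n + 1),
    #{x ∈ (leavesUpTo m τ).offDiag | blockSize m τ x.1 = blockSize m τ x.2}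
  have hfew : 4 * collisions ≤ n ! * (m + 1) := by
    refine Nat.le_of_mul_le_mul_right (c := n) ?_ (hm.trans hle)
    calc 4 * collisions * n = 4 * (collisions * n) := by ring
      _ ≤ 4 * ((m + 1) * m * (n ! * m)) := by gcongr
      _ = n ! * (m + 1) * (4 * m ^ 2) := by ring
      _ ≤ n ! * (m + 1) * n := by gcongr
  have hdistinct := sum_le_sum fun (τ : RecursiveTree (n + 1)) (_ : τ ∈ univ) =>
    card_le_card_image_add_card_collisions (leavesUpTo m τ) (blockSize m τ)
  rw [sum_add_distrib] at hdistinct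
  lia

theorem exists_iterate_parent_eq_iff {m : ℕ} (hm : m ≤ n) {τ : RecursiveTree (n + 1)}
    {i : Fin (m + 1)} (hi : NoChildIn τ i i m) (u : Fin (n + 1)) :
    (∃ k : ℕ, τ.1.parent^[k] u = i.castLE (Nat.succ_le_succ hm)) ↔ block m τ u = i := by
  set v := i.castLE (Nat.succ_le_succ hm)
  have block_eq_iff {u : Fin (n + 1)} (hu : (u : ℕ) ≤ m) : block m τ u = i ↔ u = v := by
    simp [Fin.ext_iff, val_block_of_le τ hu, v]
  induction u using WellFoundedLT.induction with
  | ind u ih =>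
    by_cases huv : u = v
    · exact iff_of_true ⟨0, huv⟩ ((block_eq_iff (huv ▸ i.is_le)).2 huv)
    by_cases hu0 : u = 0
    · have hfixed (k : ℕ) : τ.1.parent^[k] u = u :=
        Function.iterate_fixed (by rw [hu0, parent_zero]) k
      simp [hfixed, huv, block_eq_iff (show (u : ℕ) ≤ m by simp [hu0])]
    have hlt := parent_lt τ hu0
    have hstep : (∃ k : ℕ, τ.1.parent^[k] u = v) ↔ ∃ k : ℕ, τ.1.parent^[k] (τ.1.parent u) = v := by
      rw [← Nat.or_exists_add_one]
      simp [huv]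
    refine hstep.trans ((ih _ hlt).trans ?_)
    rcases le_or_gt (u : ℕ) m with hu | hu
    · rw [block_eq_iff hu, block_eq_iff (by lia)]
      exact iff_of_false (fun hparent : τ.1.parent u = v =>
        hi u (hparent ▸ hlt : v < u) hu (congrArg Fin.val hparent)) huv
    · rw [block_of_lt τ hu]

theorem size_shape_fringe {m : ℕ} (hm : m ≤ n) {τ : RecursiveTree (n + 1)}
    {i : Fin (m + 1)} (hi : NoChildIn τ i i m) :
    (τ.1.fringe (i.castLE (Nat.succ_le_succ hm))).shape.size = blockSize m τ i := by
  classical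
  calc (τ.1.fringe (i.castLE (Nat.succ_le_succ hm))).shape.size
    _ = Nat.card {u // block m τ u = i} :=
      Nat.card_congr (Equiv.subtypeEquivRight (exists_iterate_parent_eq_iff hm hi))
    _ = blockSize m τ i := by
      rw [Nat.card_eq_fintype_card, Fintype.card_subtype, blockSize]

end RecursiveTree

theorem Occurs.mem_polyaTreesLE {n : ℕ} {t : PolyaTree} {τ : RecursiveTree n} (h : Occurs t τ) :
    t ∈ polyaTreesLE n := by
  obtain ⟨v, rfl⟩ := h
  exact mem_sigma.2 ⟨mem_range.2 (Nat.lt_succ_of_le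
    ((Finite.card_subtype_le _).trans (Nat.card_fin n).le)), mem_univ _⟩

open Classical in
theorem compactedSize_eq_card {n : ℕ} (τ : RecursiveTree n) :
    compactedSize τ = #{t ∈ polyaTreesLE n | Occurs t τ} := by
  rw [compactedSize, ← Set.ncard_coe_finset]
  congr 1
  ext t
  simpa using fun h : Occurs t τ => h.mem_polyaTreesLE

open Classical in
theorem shapeContribution_succ (n : ℕ) (t : PolyaTree) :
    shapeContribution (n + 1) t = (#{τ : RecursiveTree (n + 1) | Occurs t τ} : ℝ) / n ! := by
  have hcard : Nat.card (RecursiveTree (n + 1)) = n ! := by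
    rw [Nat.card_eq_fintype_card, RecursiveTree.card_eq_factorial]
  have havoid : (Nat.card {τ : RecursiveTree (n + 1) // ¬ Occurs t τ} : ℝ) =
      (n ! : ℝ) - #{τ : RecursiveTree (n + 1) | Occurs t τ} := by
    rw [Nat.card_eq_fintype_card, Fintype.card_subtype, eq_sub_iff_add_eq', ← Nat.cast_add,
      card_filter_add_card_filter_not, card_univ, RecursiveTree.card_eq_factorial]
  have hsucc : ((n + 1)! : ℝ) ≠ 0 := by positivity
  have hfac : (n ! : ℝ) ≠ 0 := by positivity
  rw [shapeContribution, avoidingEGF, recursiveEGF, PowerSeries.coeff_mk, PowerSeries.coeff_mk,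
    havoid, hcard, div_div_div_cancel_right₀ hsucc, sub_div, div_self hfac, sub_sub_cancel]

theorem shapeContribution_nonneg {n : ℕ} (hn : 1 ≤ n) (t : PolyaTree) :
    0 ≤ shapeContribution n t := by
  classical
  obtain ⟨n, rfl⟩ := Nat.exists_eq_add_of_le' hn
  rw [shapeContribution_succ]
  positivity

open Classical in
theorem sum_shapeContribution_succ (n : ℕ) (A : Finset PolyaTree) :
    ∑ t ∈ A, shapeContribution (n + 1) t =
      (∑ τ : RecursiveTree (n + 1), (#{t ∈ A | Occurs t τ} : ℝ)) / n ! := by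
  simp only [shapeContribution_succ, ← sum_div, card_filter, Nat.cast_sum]
  rw [sum_comm]

theorem expectedCompactedSize_eq_sum_shapeContribution {n : ℕ} (hn : 1 ≤ n) :
    expectedCompactedSize n = ∑ t ∈ polyaTreesLE n, shapeContribution n t := by
  classical
  obtain ⟨n, rfl⟩ := Nat.exists_eq_add_of_le' hn
  simp only [sum_shapeContribution_succ, expectedCompactedSize, compactedSize_eq_card,
    Nat.card_eq_fintype_card, RecursiveTree.card_eq_factorial]

open Classical in
theorem RecursiveTree.card_image_blockSize_le {n m : ℕ} (hm : m ≤ n) (τ : RecursiveTree (n + 1))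
    (x : ℝ) :
    #((leavesUpTo m τ).image (blockSize m τ)) ≤
      #{t ∈ {t ∈ polyaTreesLE (n + 1) | x ≤ (t.size : ℝ)} | Occurs t τ} + ⌈x⌉₊ := by
  have hsub : (leavesUpTo m τ).image (blockSize m τ) ⊆
      image PolyaTree.size {t ∈ {t ∈ polyaTreesLE (n + 1) | x ≤ (t.size : ℝ)} | Occurs t τ} ∪
        range ⌈x⌉₊ := by
    refine image_subset_iff.2 fun i hi => ?_
    have hsize := size_shape_fringe hm ((mem_filter_univ i).1 hi)
    have hoccurs : Occurs (τ.1.fringe (i.castLE (Nat.succ_le_succ hm))).shape τ := ⟨_, rfl⟩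
    rcases lt_or_ge (blockSize m τ i) ⌈x⌉₊ with hsmall | hlarge
    · exact mem_union_right _ (mem_range.2 hsmall)
    · refine mem_union_left _ (mem_image.2 ⟨_, mem_filter.2 ⟨mem_filter.2
        ⟨hoccurs.mem_polyaTreesLE, ?_⟩, hoccurs⟩, hsize⟩)
      rw [hsize]
      exact Nat.ceil_le.1 hlarge
  exact (card_le_card hsub).trans <| (card_union_le _ _).trans <|
    add_le_add card_image_le (card_range _).le

open Classical in
theorem sub_ceil_le_sum_shapeContribution {n m : ℕ} (hm : 1 ≤ m) (hmn : 4 * m ^ 2 ≤ n) (x : ℝ) :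
    ((m + 1 : ℕ) : ℝ) / 4 - ⌈x⌉₊ ≤
      ∑ t ∈ polyaTreesLE (n + 1) with x ≤ (t.size : ℝ), shapeContribution (n + 1) t := by
  have hle : m ≤ n := by nlinarith
  have hfac : (0 : ℝ) < n ! := by positivity
  rw [sum_shapeContribution_succ, le_div_iff₀ hfac]
  have hsum := sum_le_sum fun (τ : RecursiveTree (n + 1)) (_ : τ ∈ univ) =>
    τ.card_image_blockSize_le hle x
  rw [sum_add_distrib, sum_const, card_univ, RecursiveTree.card_eq_factorial, smul_eq_mul] at hsum
  have hcount := (RecursiveTree.factorial_mul_le_four_mul_sum_card_image_blockSize hm hmn).trans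
    (Nat.mul_le_mul_left 4 hsum)
  rify at hcount
  push_cast
  linarith

open Classical in
theorem sqrt_div_eight_sub_ceil_le_sum_shapeContribution {n : ℕ} (hn : 4 ≤ n) (x : ℝ) :
    √((n + 1 : ℕ) : ℝ) / 8 - ⌈x⌉₊ ≤
      ∑ t ∈ polyaTreesLE (n + 1) with x ≤ (t.size : ℝ), shapeContribution (n + 1) t := by
  have htwo : 2 ≤ n.sqrt := Nat.le_sqrt.2 hn
  have hm : 4 * (n.sqrt / 2) ^ 2 ≤ n := by
    calc 4 * (n.sqrt / 2) ^ 2 = (2 * (n.sqrt / 2)) ^ 2 := by ring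
      _ ≤ n.sqrt ^ 2 := by gcongr; exact Nat.mul_div_le n.sqrt 2
      _ ≤ n := n.sqrt_le'
  have hsqrt : √((n + 1 : ℕ) : ℝ) ≤ 2 * ((n.sqrt / 2 + 1 : ℕ) : ℝ) := by
    rw [Real.sqrt_le_left (by positivity)]
    have hlt : n + 1 ≤ (2 * (n.sqrt / 2 + 1)) ^ 2 :=
      (Nat.lt_succ_sqrt' n).trans_le (Nat.pow_le_pow_left (by lia) 2)
    exact_mod_cast hlt
  linarith [sub_ceil_le_sum_shapeContribution (m := n.sqrt / 2) (by lia) hm x]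

open Classical in
theorem exists_sqrt_le_sum_shapeContribution {L : ℕ → ℝ} (hL : L =o[atTop] fun n => √(n : ℝ)) :
    ∃ c : ℝ, 0 < c ∧ ∃ N : ℕ, ∀ n : ℕ, N ≤ n →
      c * √n ≤ ∑ t ∈ polyaTreesLE n with L n ≤ (t.size : ℝ), shapeContribution n t := by
  obtain ⟨N, hN⟩ := eventually_atTop.1 (hL.bound (show (0 : ℝ) < 1 / 32 by norm_num))
  refine ⟨1 / 16, by norm_num, max N 1024, fun n hn => ?_⟩
  obtain ⟨hNn, hn⟩ := max_le_iff.1 hn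
  have hsqrt : 32 ≤ √(n : ℝ) := Real.le_sqrt_of_sq_le (mod_cast hn)
  have hthreshold : L n ≤ √n / 32 := by
    have := (le_abs_self _).trans (hN n hNn)
    rw [Real.norm_of_nonneg (Real.sqrt_nonneg _)] at this
    linarith
  have hceil : (⌈L n⌉₊ : ℝ) ≤ √n / 32 + 1 :=
    (Nat.cast_le.2 (Nat.ceil_mono hthreshold)).trans (Nat.ceil_lt_add_one (by positivity)).le
  have hlarge : √(n : ℝ) / 8 - ⌈L n⌉₊ ≤
      ∑ t ∈ polyaTreesLE n with L n ≤ (t.size : ℝ), shapeContribution n t := by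
    obtain ⟨n, rfl⟩ := Nat.exists_eq_add_of_le' (show 1 ≤ n by lia)
    exact sqrt_div_eight_sub_ceil_le_sum_shapeContribution (by lia) _
  linarith

theorem polyaLog_isLittleO : (fun n : ℕ => polyaLog n) =o[atTop] fun n : ℕ => √(n : ℝ) := by
  have hlog : (fun n : ℕ => Real.log n) =o[atTop] fun n : ℕ => √(n : ℝ) := by
    simpa only [Function.comp_def, Real.sqrt_eq_rpow] using
      (isLittleO_log_rpow_atTop one_half_pos).comp_tendsto (tendsto_natCast_atTop_atTop (R := ℝ))
  simpa only [polyaLog, Real.logb, div_eq_inv_mul] using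
    hlog.const_mul_left (Real.log (1 / polyaSingularity))⁻¹

open Classical in
theorem mainTheorem3_general {L : ℕ → ℝ} (hL : L =o[atTop] fun n => √(n : ℝ)) :
    (∀ n : ℕ, 1 ≤ n → expectedCompactedSize n =
      ∑ t ∈ polyaTreesLE n with (t.size : ℝ) < L n, shapeContribution n t +
        ∑ t ∈ polyaTreesLE n with L n ≤ (t.size : ℝ), shapeContribution n t) ∧
    (∃ c : ℝ, 0 < c ∧ ∃ N : ℕ, ∀ n : ℕ, N ≤ n →
      c * √n ≤ ∑ t ∈ polyaTreesLE n with L n ≤ (t.size : ℝ), shapeContribution n t) ∧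
    (∃ c : ℝ, 0 < c ∧ ∃ N : ℕ, ∀ n : ℕ, N ≤ n → c * √n ≤ expectedCompactedSize n) := by
  obtain ⟨c, hc, N, hN⟩ := exists_sqrt_le_sum_shapeContribution hL
  refine ⟨fun n hn => ?_, ⟨c, hc, N, hN⟩, c, hc, max N 1, fun n hn => ?_⟩
  · simp only [expectedCompactedSize_eq_sum_shapeContribution hn, ← not_lt,
      sum_filter_add_sum_filter_not]
  · obtain ⟨hNn, hn1⟩ := max_le_iff.1 hn
    rw [expectedCompactedSize_eq_sum_shapeContribution hn1]
    exact (hN n hNn).trans <| sum_le_sum_of_subset_of_nonneg (filter_subset _ _)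
      fun t _ _ => shapeContribution_nonneg hn1 t

theorem mainTheorem3 :
    (∀ n : ℕ, 1 ≤ n → expectedCompactedSize n = smallShapeSum n + largeShapeSum n) ∧
    (∃ c : ℝ, 0 < c ∧ ∃ N : ℕ, ∀ n : ℕ, N ≤ n → c * Real.sqrt n ≤ largeShapeSum n) ∧
    (∃ c : ℝ, 0 < c ∧ ∃ N : ℕ, ∀ n : ℕ, N ≤ n → c * Real.sqrt n ≤ expectedCompactedSize n) :=
  mainTheorem3_general polyaLog_isLittleO
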